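/- Let $\mathcal H,\mathcal F,\mathcal Y$ be real Hilbert spaces, $L:\mathcal D(L)\subset\mathcal H\to\mathcal F$ a closed densely defined linear operator, $H:\mathcal H\to\mathcal Y$ a bounded linear operator, and $Q_1$ on $\mathcal F$, $Q_2$ on $\mathcal Y$ bounded self-adjoint positive operators with bounded inverses. Write $R(\cdot)$ for the range and $N(\cdot)$ for the null space. Suppose that either (Assumption 1) the sets $R(L)$ and $H(N(L))$ are closed, or (Assumption 2) the set $\{[Lx,Hx]:x\in\mathcal D(L)\}$ is closed in $\mathcal F\times\mathcal Y$. Let $G=\{(f,\eta):(Q_1f,f)+(Q_2\eta,\eta)\le1\}$, let $y\in\mathcal Y$ be such that the a posteriori set $G_y=\{\varphi\in\mathcal D(L):(L\varphi,y-H\varphi)\in G\}$ is non-empty, and let $$\rho_\ell(\varphi)=\sup_{\psi\in G_y}|(\ell,\varphi)-(\ell,\psi)|,\qquad \hat\rho(\ell)=\inf_{\varphi\in G_y}\rho_\ell(\varphi)\in[0,\infty]$$ be the minimax a posteriori error in the direction $\ell\in\mathcal H$; the minimax a posteriori estimation in the direction $\ell$ is the center of the interval $\ell(G_y)=\{(\ell,\psi):\psi\in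 G_y\}$. Let further $$\hat\sigma(\ell)=\Bigl(\inf_{u\in\mathcal Y,\,c\in\mathbb R}\ \sup_{\varphi,\eta}\ M\bigl((\ell,\varphi)-(u,H\varphi+\eta)-c\bigr)^2\Bigr)^{1/2}\in[0,\infty]$$ be the minimax a priori error, where $M$ is the expectation and the supremum is over all $\varphi\in\mathcal D(L)$ with $(Q_1L\varphi,L\varphi)\le1$ and all zero-mean random elements $\eta$ of $\mathcal Y$ with $M(Q_2\eta,\eta)\le1$. Then the following holds. 1. $\hat\rho(\ell)<\infty$ if and only if $\ell\in R(L^*)+R(H^*)$. 2. The system $$L^*\hat q=H^*Q_2(y-H\hat\varphi),\qquad L\hat\varphi=Q_1^{-1}\hat q$$ has a solution $(\hat\varphi,\hat q)\in\mathcal D(L)\times\mathcal D(L^*)$. For each solution, $\hat\varphi\in G_y$ and $1-(Q_2y,y-H\hat\varphi)\ge0$, and for each $\ell\in R(L^*)+R(H^*)$ $$\hat\rho(\ell)=\rho_\ell(\hat\varphi)=\bigl(1-(Q_2y,y-H\hat\varphi)\bigr)^{1/2}\hat\sigma(\ell),$$ and the minimax a posteriori estimation in the direction $\ell$ is $(\ell,\hat\varphi)=(\hat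 u,y)$. Here $\hat u=Q_2H\hat p$, where $(\hat p,\hat z)\in\mathcal D(L)\times\mathcal D(L^*)$ is any solution of $L^*\hat z=\ell-H^*Q_2H\hat p$, $L\hat p=Q_1^{-1}\hat z$; such solutions exist, and for each of them $y\mapsto(\hat u,y)$ is a minimax a priori estimation, that is, $(u,c)=(\hat u,0)$ attains the infimum in the definition of $\hat\sigma(\ell)$. 3. If $\hat\rho(\ell)<\infty$ for every $\ell\in\mathcal H$, then for each solution of the system in 2 $$\inf_{\varphi\in G_y}\sup_{x\in G_y}\|\varphi-x\|=\sup_{x\in G_y}\|\hat\varphi-x\|=\bigl(1-(Q_2y,y-H\hat\varphi)\bigr)^{1/2}\sup_{\|\ell\|=1}\hat\sigma(\ell)<\infty$$ (the last supremum being $0$ if $\mathcal H=\{0\}$), and $\hat\varphi$ is the only point of $G_y$ that attains the infimum: it is the Chebyshev center of $G_y$. -/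

import Mathlib

open MeasureTheory
open scoped ENNReal

noncomputable section

namespace MinimaxEstimation

variable {X F Y : Type*}
  [NormedAddCommGroup X] [InnerProductSpace ℝ X] [CompleteSpace X]
  [NormedAddCommGroup F] [InnerProductSpace ℝ F] [CompleteSpace F]
  [NormedAddCommGroup Y] [InnerProductSpace ℝ Y] [CompleteSpace Y]

/-- The sets `R(L)` and `H(N(L))` are closed. -/
def Assumption1 (L : X →ₗ.[ℝ] F) (H : X →L[ℝ] Y) : Prop :=
  IsClosed (Set.range fun x : L.domain => L x) ∧
    IsClosed {v : Y | ∃ x : L.domain, L x = 0 ∧ H (x : X) = v}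

/-- The set `R(T) = {[Lx, Hx] : x ∈ D(L)}` is closed in `F × Y`. -/
def Assumption2 (L : X →ₗ.[ℝ] F) (H : X →L[ℝ] Y) : Prop :=
  IsClosed (Set.range fun x : L.domain => ((L x, H (x : X)) : F × Y))

/-- The linear set `R(L*) + R(H*)`. -/
def adjointRangeSum (L : X →ₗ.[ℝ] F) (H : X →L[ℝ] Y) : Submodule ℝ X :=
  LinearMap.range L.adjoint.toFun ⊔
    LinearMap.range (ContinuousLinearMap.adjoint H : Y →ₗ[ℝ] X)

/-! ### A priori estimation (random noise) -/

/-- The admissible laws of the noise: Borel probability measures on `Y` with zero mean (so that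
the second moments of the noise are those of its correlation operator) and `M(Q₂η, η) ≤ 1`. -/
def noiseLaws [MeasurableSpace Y] (Q₂ : Y ≃L[ℝ] Y) : Set (Measure Y) :=
  {μ | IsProbabilityMeasure μ ∧ (∀ u : Y, ∫ η, inner ℝ u η ∂μ = 0) ∧
    ∫⁻ η, ENNReal.ofReal (inner ℝ (Q₂ η) η) ∂μ ≤ 1}

/-- The worst mean squared error `sup M((ℓ, φ) - (u, y) - c)²` with `y = Hφ + η`, over all
`φ ∈ D(L)` with `(Q₁Lφ, Lφ) ≤ 1` and over all admissible laws of the noise `η`. -/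
def aPrioriRisk [MeasurableSpace Y] (L : X →ₗ.[ℝ] F) (H : X →L[ℝ] Y) (Q₁ : F ≃L[ℝ] F)
    (Q₂ : Y ≃L[ℝ] Y) (ℓ : X) (u : Y) (c : ℝ) : ℝ≥0∞ :=
  ⨆ (φ : L.domain) (_ : inner ℝ (Q₁ (L φ)) (L φ) ≤ 1) (μ : Measure Y) (_ : μ ∈ noiseLaws Q₂),
    ∫⁻ η, ENNReal.ofReal ((inner ℝ ℓ (φ : X) - (inner ℝ u (H (φ : X) + η) + c)) ^ 2) ∂μ

/-- The minimax a priori error `σ̂(ℓ)`: the root of the minimal worst mean squared error. -/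
def aPrioriError [MeasurableSpace Y] (L : X →ₗ.[ℝ] F) (H : X →L[ℝ] Y) (Q₁ : F ≃L[ℝ] F)
    (Q₂ : Y ≃L[ℝ] Y) (ℓ : X) : ℝ≥0∞ :=
  (⨅ (u : Y) (c : ℝ), aPrioriRisk L H Q₁ Q₂ ℓ u c) ^ (1 / 2 : ℝ)

/-- The affine map `y ↦ (u, y) + c` is a minimax a priori estimation of `(ℓ, φ)`. -/
def IsAPrioriEstimation [MeasurableSpace Y] (L : X →ₗ.[ℝ] F) (H : X →L[ℝ] Y) (Q₁ : F ≃L[ℝ] F)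
    (Q₂ : Y ≃L[ℝ] Y) (ℓ : X) (u : Y) (c : ℝ) : Prop :=
  ∀ (u' : Y) (c' : ℝ), aPrioriRisk L H Q₁ Q₂ ℓ u c ≤ aPrioriRisk L H Q₁ Q₂ ℓ u' c'

/-- The system `L*z = ℓ - H*Q₂Hp`, `Lp = Q₁⁻¹z`. -/
def APrioriEuler (L : X →ₗ.[ℝ] F) (H : X →L[ℝ] Y) (Q₁ : F ≃L[ℝ] F) (Q₂ : Y ≃L[ℝ] Y)
    (ℓ : X) (p : L.domain) (z : L.adjoint.domain) : Prop :=
  L.adjoint z = ℓ - ContinuousLinearMap.adjoint H (Q₂ (H (p : X))) ∧ L p = Q₁.symm (z : F)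

/-! ### A posteriori estimation (deterministic noise) -/

/-- The joint ellipsoid `{(f, η) : (Q₁f, f) + (Q₂η, η) ≤ 1}`. -/
def jointEllipsoid (Q₁ : F ≃L[ℝ] F) (Q₂ : Y ≃L[ℝ] Y) : Set (F × Y) :=
  {w | inner ℝ (Q₁ w.1) w.1 + inner ℝ (Q₂ w.2) w.2 ≤ 1}

/-- The a posteriori set `G_y = {φ ∈ D(L) : (Lφ, y - Hφ) ∈ G}`. -/
def aPosterioriSet (L : X →ₗ.[ℝ] F) (H : X →L[ℝ] Y) (Q₁ : F ≃L[ℝ] F) (Q₂ : Y ≃L[ℝ] Y)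
    (y : Y) : Set X :=
  {φ | ∃ x : L.domain, (x : X) = φ ∧ (L x, y - H φ) ∈ jointEllipsoid Q₁ Q₂}

/-- `ρ(φ) = sup_{ψ ∈ G} |(ℓ, φ) - (ℓ, ψ)|`. -/
def directionalRadiusAt (G : Set X) (ℓ φ : X) : ℝ≥0∞ :=
  ⨆ ψ ∈ G, ENNReal.ofReal |inner ℝ ℓ φ - inner ℝ ℓ ψ|

/-- The minimax a posteriori error `ρ̂(ℓ) = inf_{φ ∈ G} ρ(φ)` in the direction `ℓ`,
for the a posteriori set `G`. -/
def aPosterioriError (G : Set X) (ℓ : X) : ℝ≥0∞ :=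
  ⨅ φ ∈ G, directionalRadiusAt G ℓ φ

/-- The number `e` is the minimax a posteriori estimation of `(ℓ, φ)`: the center of the
(bounded) interval `ℓ(G)`. -/
def IsAPosterioriEstimation (G : Set X) (ℓ : X) (e : ℝ) : Prop :=
  ∃ a b : ℝ, IsGLB ((fun ψ : X => (inner ℝ ℓ ψ : ℝ)) '' G) a ∧
    IsLUB ((fun ψ : X => (inner ℝ ℓ ψ : ℝ)) '' G) b ∧ e = (a + b) / 2

/-- `sup_{x ∈ G} ‖φ - x‖`. -/
def radiusAt (G : Set X) (φ : X) : ℝ≥0∞ :=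
  ⨆ x ∈ G, ENNReal.ofReal ‖φ - x‖

/-- The system `L*q = H*Q₂(y - Hφ)`, `Lφ = Q₁⁻¹q`. -/
def APosterioriEuler (L : X →ₗ.[ℝ] F) (H : X →L[ℝ] Y) (Q₁ : F ≃L[ℝ] F) (Q₂ : Y ≃L[ℝ] Y)
    (y : Y) (φ : L.domain) (q : L.adjoint.domain) : Prop :=
  L.adjoint q = ContinuousLinearMap.adjoint H (Q₂ (y - H (φ : X))) ∧ L φ = Q₁.symm (q : F)

end MinimaxEstimation

end

/-!
Write `T x = [Lx, Hx]` for `x ∈ D(L)` and let `B(x, x') = (Q₁Lx, Lx') + (Q₂Hx, Hx')` be the energy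
form (`energyForm`).

*Closed range.* Assumption 1 implies Assumption 2 (`Assumption1.assumption2`), so `T` is a closed
operator with closed range. The open mapping theorem on its graph shows that every vector orthogonal
to `N(T)` has the form `L*z + H*u` (`exists_inner_eq_add_of_ker`). Since `Q₁` and `Q₂` are coercive,
Lax–Milgram on `R(T)` solves `B(p, x) = (z, Lx) + (u, Hx)` (`exists_energyForm_eq`); both Euler
systems are equations of this type: `B(p, ·) = ℓ` and `B(φ, ·) = (Q₂y, H·)`.

*A posteriori set.* At a solution `φ` of the second equation the quadratic functional defining `G_y`
has no linear term, so that `G_y` is the ellipsoid `φ + {d : B(d, d) ≤ b}` with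
`b = 1 - (Q₂y, y - Hφ)` (`aPosterioriSet_eq_ellipsoid`). For `ℓ = B(p, ·)` the Cauchy–Schwarz
inequality and its equality case show that `ℓ(G_y)` is the interval with centre `(ℓ, φ)` and
half-length `√b √B(p, p)`. If the directional error is finite, then `ℓ` vanishes on `N(T)`, because
`G_y` contains the lines `φ + N(T)`.

*A priori error.* The risk of `(u, c)` is the supremum of squared bias plus variance. Cauchy–Schwarz
bounds it by `B(p, p)` for `u = Q₂Hp`, `c = 0`, while the least favourable data, proportional to
`p`, with a symmetric two-point noise proportional to `Hp`, give the same lower bound for all `(u, c)`.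
Hence `σ̂(ℓ) = √B(p, p)` (`aPrioriError_eq_ofReal_sqrt_energyForm`).

*Chebyshev centre.* The norm is the supremum of the unit functionals, which turns the directional
identities into the one for the radius, and the parallelogram law shows that the centre of a bounded
symmetric set is its only Chebyshev centre (`eq_of_radiusAt_eq_of_symmetric`).
-/

/-! ### Closed operators with closed range -/

namespace LinearPMap

variable {E₁ E₂ : Type*}

/-- The open mapping theorem for a closed unbounded operator with closed range, obtained from the
bounded surjection of the graph onto the range. -/
theorem exists_preimage_norm_le_of_isClosed_range
    [NormedAddCommGroup E₁] [NormedSpace ℝ E₁] [CompleteSpace E₁]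
    [NormedAddCommGroup E₂] [NormedSpace ℝ E₂] [CompleteSpace E₂]
    {A : E₁ →ₗ.[ℝ] E₂} (hA : A.IsClosed)
    (hR : _root_.IsClosed (Set.range fun x : A.domain => A x)) :
    ∃ C : ℝ, 0 < C ∧
      ∀ x : A.domain, ∃ x' : A.domain, A x' = A x ∧ ‖(x' : E₁)‖ ≤ C * ‖A x‖ := by
  have hR' : _root_.IsClosed (LinearMap.range A.toFun : Set E₂) := hR
  have : CompleteSpace A.graph := hA.completeSpace_coe
  have : CompleteSpace (LinearMap.range A.toFun) := hR'.completeSpace_coe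
  have hmem (g : A.graph) : (g : E₁ × E₂).2 ∈ LinearMap.range A.toFun := by
    obtain ⟨x, -, hx⟩ := A.mem_graph_iff.1 g.2
    exact ⟨x, hx⟩
  let S : A.graph →L[ℝ] LinearMap.range A.toFun :=
    ((ContinuousLinearMap.snd ℝ E₁ E₂).comp A.graph.subtypeL).codRestrict _ hmem
  have hS : Function.Surjective S := by
    rintro ⟨_, x, rfl⟩
    exact ⟨⟨((x : E₁), A x), A.mem_graph x⟩, rfl⟩
  obtain ⟨C, hC, h⟩ := S.exists_preimage_norm_le hS
  refine ⟨C, hC, fun x => ?_⟩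
  obtain ⟨g, hg, hgC⟩ := h ⟨A x, x, rfl⟩
  obtain ⟨x', hx', hAx'⟩ := A.mem_graph_iff.1 g.2
  have hg2 : (g : E₁ × E₂).2 = A x := congrArg Subtype.val hg
  refine ⟨x', hAx'.trans hg2, ?_⟩
  rw [hx']
  exact (norm_fst_le (g : E₁ × E₂)).trans hgC

/-- One half of the closed range theorem: a vector orthogonal to the kernel of a closed operator
with closed range is represented through the operator. The functional `A x ↦ (ℓ, x)` is bounded on
the range by the open mapping theorem, and the representing vector is given by Riesz. -/
theorem exists_inner_eq_of_isClosed_range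
    [NormedAddCommGroup E₁] [InnerProductSpace ℝ E₁] [CompleteSpace E₁]
    [NormedAddCommGroup E₂] [InnerProductSpace ℝ E₂] [CompleteSpace E₂]
    {A : E₁ →ₗ.[ℝ] E₂} (hA : A.IsClosed) (hR : _root_.IsClosed (Set.range fun x : A.domain => A x))
    {ℓ : E₁} (hℓ : ∀ x : A.domain, A x = 0 → inner ℝ ℓ (x : E₁) = 0) :
    ∃ w : E₂, ∀ x : A.domain, inner ℝ ℓ (x : E₁) = inner ℝ w (A x) := by
  obtain ⟨C, hC, hpre⟩ := exists_preimage_norm_le_of_isClosed_range hA hR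
  have hR' : _root_.IsClosed (LinearMap.range A.toFun : Set E₂) := hR
  have : CompleteSpace (LinearMap.range A.toFun) := hR'.completeSpace_coe
  let f : A.domain →ₗ[ℝ] ℝ := (innerₛₗ ℝ ℓ).comp A.domain.subtype
  have hker : LinearMap.ker A.toFun ≤ LinearMap.ker f := fun x hx => hℓ x hx
  let g : LinearMap.range A.toFun →ₗ[ℝ] ℝ :=
    ((LinearMap.ker A.toFun).liftQ f hker).comp
      A.toFun.quotKerEquivRange.symm.toLinearMap
  have hg (x : A.domain) : g ⟨A x, x, rfl⟩ = inner ℝ ℓ (x : E₁) := by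
    have : A.toFun.quotKerEquivRange.symm ⟨A x, x, rfl⟩ = Submodule.Quotient.mk x := by
      rw [LinearEquiv.symm_apply_eq]
      rfl
    simp only [g, LinearMap.comp_apply, LinearEquiv.coe_coe, this]
    rfl
  have hbound : ∀ v, ‖g v‖ ≤ (‖ℓ‖ * C) * ‖v‖ := by
    rintro ⟨_, x, rfl⟩
    obtain ⟨x', hx', hx'C⟩ := hpre x
    have hv : (⟨A.toFun x, x, rfl⟩ : LinearMap.range A.toFun) = ⟨A x', x', rfl⟩ :=
      Subtype.ext hx'.symm
    rw [hv, hg, mul_assoc]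
    refine (norm_inner_le_norm _ _).trans ?_
    gcongr
    simpa [hx'] using hx'C
  refine ⟨((InnerProductSpace.toDual ℝ _).symm (g.mkContinuous _ hbound) :
    LinearMap.range A.toFun), fun x => ?_⟩
  rw [← hg]
  have := InnerProductSpace.toDual_symm_apply (𝕜 := ℝ)
    (x := (⟨A x, x, rfl⟩ : LinearMap.range A.toFun)) (y := g.mkContinuous _ hbound)
  rw [Submodule.coe_inner] at this
  exact this.symm

end LinearPMap

/-! ### Coercivity of positive invertible operators -/

/-- A positive operator with bounded inverse is coercive, by the Cauchy–Schwarz inequality for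
its quadratic form applied to `x` and `Q x`. -/
theorem ContinuousLinearEquiv.exists_mul_norm_sq_le_of_isPositive {E : Type*}
    [NormedAddCommGroup E] [InnerProductSpace ℝ E] [CompleteSpace E]
    (Q : E ≃L[ℝ] E) (hQ : (Q : E →L[ℝ] E).IsPositive) :
    ∃ c : ℝ, 0 < c ∧ ∀ x, c * ‖x‖ ^ 2 ≤ inner ℝ (Q x) x := by
  let B : LinearMap.BilinForm ℝ E := (innerₗ E).comp (Q : E →L[ℝ] E).toLinearMap
  have hB (x x' : E) : B x x' = inner ℝ (Q x) x' := rfl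
  have hnn (x : E) : 0 ≤ B x x := hQ.inner_nonneg_left x
  have hsymm : LinearMap.IsSymm B := ⟨fun x x' => by
    simp only [hB]
    rw [real_inner_comm]
    exact (hQ.inner_left_eq_inner_right x' x).symm⟩
  set M : ℝ := ‖(Q : E →L[ℝ] E)‖ + 1
  set N : ℝ := ‖(Q.symm : E →L[ℝ] E)‖ + 1
  have hM : 0 < M := by positivity
  have hN : 0 < N := by positivity
  refine ⟨(N ^ 2 * M)⁻¹, by positivity, fun x => ?_⟩
  have h1 : ‖Q x‖ ^ 2 ≤ M * inner ℝ (Q x) x := by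
    have hcs := LinearMap.BilinForm.apply_sq_le_of_symm B hnn hsymm x (Q x)
    simp only [hB, real_inner_self_eq_norm_sq] at hcs
    have hQQ : inner ℝ (Q (Q x)) (Q x) ≤ M * ‖Q x‖ ^ 2 := by
      have hle : ‖Q (Q x)‖ ≤ ‖(Q : E →L[ℝ] E)‖ * ‖Q x‖ := (Q : E →L[ℝ] E).le_opNorm (Q x)
      calc inner ℝ (Q (Q x)) (Q x) ≤ ‖Q (Q x)‖ * ‖Q x‖ := real_inner_le_norm _ _
        _ ≤ (M * ‖Q x‖) * ‖Q x‖ := by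
            gcongr
            exact hle.trans (by gcongr; simp [M])
        _ = M * ‖Q x‖ ^ 2 := by ring
    rcases (sq_nonneg ‖Q x‖).eq_or_lt with h0 | h0
    · rw [← h0]
      exact mul_nonneg hM.le (hnn x)
    · refine le_of_mul_le_mul_right ?_ h0
      calc ‖Q x‖ ^ 2 * ‖Q x‖ ^ 2 = (‖Q x‖ ^ 2) ^ 2 := by ring
        _ ≤ inner ℝ (Q x) x * inner ℝ (Q (Q x)) (Q x) := hcs
        _ ≤ inner ℝ (Q x) x * (M * ‖Q x‖ ^ 2) := mul_le_mul_of_nonneg_left hQQ (hnn x)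
        _ = M * inner ℝ (Q x) x * ‖Q x‖ ^ 2 := by ring
  have h2 : ‖x‖ ≤ N * ‖Q x‖ := by
    have hle := (Q.symm : E →L[ℝ] E).le_opNorm (Q x)
    simp only [ContinuousLinearEquiv.coe_coe, ContinuousLinearEquiv.symm_apply_apply] at hle
    exact hle.trans (by gcongr; simp [N])
  rw [inv_mul_le_iff₀ (by positivity)]
  calc ‖x‖ ^ 2 ≤ (N * ‖Q x‖) ^ 2 := by gcongr
    _ = N ^ 2 * ‖Q x‖ ^ 2 := by ring
    _ ≤ N ^ 2 * (M * inner ℝ (Q x) x) := by gcongr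
    _ = N ^ 2 * M * inner ℝ (Q x) x := by ring

noncomputable section

namespace MinimaxEstimation

variable {X F Y : Type*}
  [NormedAddCommGroup X] [InnerProductSpace ℝ X]
  [NormedAddCommGroup F] [InnerProductSpace ℝ F]
  [NormedAddCommGroup Y] [InnerProductSpace ℝ Y]

/-! ### The joint operator `x ↦ [Lx, Hx]` -/

/-- The operator `x ↦ [Lx, Hx]` with domain `D(L)`, into the Hilbert space product of `F` and
`Y`. -/
def jointMap (L : X →ₗ.[ℝ] F) (H : X →L[ℝ] Y) : X →ₗ.[ℝ] WithLp 2 (F × Y) where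
  domain := L.domain
  toFun := (WithLp.linearEquiv 2 ℝ (F × Y)).symm.toLinearMap ∘ₗ
    L.toFun.prod (H.toLinearMap ∘ₗ L.domain.subtype)

variable {L : X →ₗ.[ℝ] F} {H : X →L[ℝ] Y} {Q₁ : F ≃L[ℝ] F} {Q₂ : Y ≃L[ℝ] Y}

theorem isClosed_jointMap (hL : L.IsClosed) : (jointMap L H).IsClosed := by
  have hgraph : ((jointMap L H).graph : Set (X × WithLp 2 (F × Y))) =
      (fun w : X × WithLp 2 (F × Y) => (w.1, w.2.fst)) ⁻¹' (L.graph : Set (X × F)) ∩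
        {w | H w.1 = w.2.snd} := by
    ext ⟨x, w⟩
    simp only [SetLike.mem_coe, Set.mem_inter_iff, Set.mem_preimage, Set.mem_ofPred_eq,
      LinearPMap.mem_graph_iff]
    constructor
    · rintro ⟨x', rfl, rfl⟩
      exact ⟨⟨x', rfl, rfl⟩, rfl⟩
    · rintro ⟨⟨x', rfl, h⟩, h'⟩
      exact ⟨x', rfl, (WithLp.ofLp_injective 2) (Prod.ext h h')⟩
  unfold LinearPMap.IsClosed
  rw [hgraph]
  refine IsClosed.inter (IsClosed.preimage ?_ hL) (isClosed_eq ?_ ?_)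
  · exact continuous_fst.prodMk (((WithLp.prod_continuous_ofLp 2 F Y).comp continuous_snd).fst)
  · exact H.continuous.comp continuous_fst
  · exact ((WithLp.prod_continuous_ofLp 2 F Y).comp continuous_snd).snd

theorem isClosed_range_jointMap (h : Assumption2 L H) :
    IsClosed (Set.range fun x : (jointMap L H).domain => jointMap L H x) := by
  have : (Set.range fun x : (jointMap L H).domain => jointMap L H x) =
      WithLp.ofLp ⁻¹' (Set.range fun x : L.domain => ((L x, H (x : X)) : F × Y)) := by
    ext w
    constructor
    · rintro ⟨x, rfl⟩
      exact ⟨x, rfl⟩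
    · rintro ⟨x, hx⟩
      exact ⟨x, (WithLp.ofLp_injective 2) hx⟩
  rw [this]
  exact h.preimage (WithLp.prod_continuous_ofLp 2 F Y)

/-- Closedness of `R(L)` and `H(N(L))` implies closedness of `{[Lx, Hx]}`: a limit `[f, v]` of
`[L xₙ, H xₙ]` has `f = L a`, and the open mapping theorem corrects `xₙ - a` by a null sequence
to an element of `N(L)`. -/
theorem Assumption1.assumption2 [CompleteSpace X] [CompleteSpace F] (hL : L.IsClosed)
    (h : Assumption1 L H) : Assumption2 L H := by
  obtain ⟨C, hC, hpre⟩ := LinearPMap.exists_preimage_norm_le_of_isClosed_range hL h.1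
  refine IsSeqClosed.isClosed fun w w₀ hw hlim => ?_
  choose x hx using hw
  obtain ⟨f, v⟩ := w₀
  have hLx : Filter.Tendsto (fun n => L (x n)) Filter.atTop (nhds f) := by
    have := (continuous_fst.tendsto _).comp hlim
    refine this.congr fun n => ?_
    simp [← hx]
  have hHx : Filter.Tendsto (fun n => H (x n)) Filter.atTop (nhds v) := by
    have := (continuous_snd.tendsto _).comp hlim
    refine this.congr fun n => ?_
    simp [← hx]
  obtain ⟨a, ha⟩ : f ∈ Set.range fun x : L.domain => L x :=
    h.1.mem_of_tendsto hLx (Filter.Eventually.of_forall fun n => ⟨x n, rfl⟩)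
  choose r hr hrC using fun n => hpre (x n - a)
  have hr0 : Filter.Tendsto (fun n => (r n : X)) Filter.atTop (nhds 0) := by
    refine squeeze_zero_norm hrC ?_
    have : Filter.Tendsto (fun n => C * ‖L (x n) - f‖) Filter.atTop (nhds (C * ‖f - f‖)) :=
      ((hLx.sub_const f).norm).const_mul C
    simp only [sub_self, norm_zero, mul_zero] at this
    refine this.congr fun n => ?_
    rw [L.map_sub, ← ha]
  have hH : Filter.Tendsto (fun n => H (x n) - H a - H (r n)) Filter.atTop
      (nhds (v - H a - 0)) := by
    have := (H.continuous.tendsto 0).comp hr0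
    rw [map_zero] at this
    exact (hHx.sub_const _).sub this
  obtain ⟨b, hb, hHb⟩ : v - H a - 0 ∈ {v : Y | ∃ x : L.domain, L x = 0 ∧ H (x : X) = v} := by
    refine h.2.mem_of_tendsto hH (Filter.Eventually.of_forall fun n => ⟨x n - a - r n, ?_, ?_⟩)
    · rw [L.map_sub, hr, sub_self]
    · simp
  refine ⟨a + b, Prod.ext ?_ ?_⟩
  · change L (a + b) = f
    rw [L.map_add, hb, add_zero]
    exact ha
  · simp [hHb]

/-- Elements of `D(L)` can be corrected by `N(L) ∩ N(H)` to be bounded in terms of `[Lx, Hx]`. -/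
theorem exists_norm_le_norm_jointMap [CompleteSpace X] [CompleteSpace F] [CompleteSpace Y]
    (hL : L.IsClosed) (hA : Assumption2 L H) :
    ∃ C : ℝ, 0 < C ∧ ∀ x : L.domain, ∃ x' : L.domain, L x' = L x ∧ H (x' : X) = H (x : X) ∧
      ‖(x' : X)‖ ≤ C * ‖WithLp.toLp 2 (L x, H (x : X))‖ := by
  have h₁ := isClosed_jointMap (H := H) hL
  have h₂ := isClosed_range_jointMap hA
  obtain ⟨C, hC, h⟩ :=
    LinearPMap.exists_preimage_norm_le_of_isClosed_range (A := jointMap L H) h₁ h₂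
  refine ⟨C, hC, fun x => ?_⟩
  obtain ⟨x', hx', hle⟩ := h x
  exact ⟨x', congrArg WithLp.fst hx', congrArg WithLp.snd hx', hle⟩

/-- A vector orthogonal to `N(L) ∩ N(H)` is a functional of `[Lx, Hx]`. -/
theorem exists_inner_eq_add_of_ker [CompleteSpace X] [CompleteSpace F] [CompleteSpace Y]
    (hL : L.IsClosed) (hA : Assumption2 L H) {ℓ : X}
    (hℓ : ∀ x : L.domain, L x = 0 → H (x : X) = 0 → inner ℝ ℓ (x : X) = 0) :
    ∃ (z : F) (u : Y), ∀ x : L.domain,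
      inner ℝ ℓ (x : X) = inner ℝ z (L x) + inner ℝ u (H (x : X)) := by
  have h₁ := isClosed_jointMap (H := H) hL
  have h₂ := isClosed_range_jointMap hA
  have hker (x : L.domain) (hx : jointMap L H x = 0) : inner ℝ ℓ (x : X) = 0 :=
    hℓ x (congrArg WithLp.fst hx) (congrArg WithLp.snd hx)
  obtain ⟨w, hw⟩ :=
    LinearPMap.exists_inner_eq_of_isClosed_range (A := jointMap L H) h₁ h₂ hker
  refine ⟨w.fst, w.snd, fun x => (hw x).trans ?_⟩
  rw [WithLp.prod_inner_apply]
  rfl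

/-! ### The energy form -/

/-- The bilinear form `(Q₁Lx, Lx') + (Q₂Hx, Hx')` on `D(L)`. -/
def energyForm (L : X →ₗ.[ℝ] F) (H : X →L[ℝ] Y) (Q₁ : F ≃L[ℝ] F) (Q₂ : Y ≃L[ℝ] Y) :
    LinearMap.BilinForm ℝ L.domain :=
  LinearMap.mk₂ ℝ (fun x x' => inner ℝ (Q₁ (L x)) (L x') + inner ℝ (Q₂ (H (x : X))) (H (x' : X)))
    (fun x₁ x₂ x' => by
      simp only [L.map_add, Submodule.coe_add, map_add, inner_add_left]
      ring)
    (fun c x x' => by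
      simp only [L.map_smul, Submodule.coe_smul, map_smul, inner_smul_left, smul_eq_mul,
        conj_trivial]
      ring)
    (fun x x₁ x₂ => by
      simp only [L.map_add, Submodule.coe_add, map_add, inner_add_right]
      ring)
    (fun c x x' => by
      simp only [L.map_smul, Submodule.coe_smul, map_smul, inner_smul_right, smul_eq_mul]
      ring)

theorem energyForm_apply (x x' : L.domain) : energyForm L H Q₁ Q₂ x x' =
    inner ℝ (Q₁ (L x)) (L x') + inner ℝ (Q₂ (H (x : X))) (H (x' : X)) := rfl

theorem energyForm_nonneg (hQ₁ : (Q₁ : F →L[ℝ] F).IsPositive) (hQ₂ : (Q₂ : Y →L[ℝ] Y).IsPositive)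
    (x : L.domain) : 0 ≤ energyForm L H Q₁ Q₂ x x :=
  add_nonneg (hQ₁.inner_nonneg_left _) (hQ₂.inner_nonneg_left _)

theorem inner_apply_comm_of_isPositive {Q : Y ≃L[ℝ] Y} (hQ : (Q : Y →L[ℝ] Y).IsPositive)
    (v v' : Y) : inner ℝ (Q v) v' = inner ℝ (Q v') v := by
  rw [real_inner_comm]
  exact (hQ.inner_left_eq_inner_right v' v).symm

/-- The Cauchy–Schwarz inequality for the quadratic form of a positive operator. -/
theorem inner_apply_sq_le_of_isPositive {Q : Y ≃L[ℝ] Y} (hQ : (Q : Y →L[ℝ] Y).IsPositive)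
    (v v' : Y) : inner ℝ (Q v) v' ^ 2 ≤ inner ℝ (Q v) v * inner ℝ (Q v') v' :=
  LinearMap.BilinForm.apply_sq_le_of_symm ((innerₗ Y).comp (Q : Y →L[ℝ] Y).toLinearMap)
    (fun x => hQ.inner_nonneg_left x) ⟨inner_apply_comm_of_isPositive hQ⟩ v v'

theorem energyForm_isSymm (hQ₁ : (Q₁ : F →L[ℝ] F).IsPositive)
    (hQ₂ : (Q₂ : Y →L[ℝ] Y).IsPositive) : LinearMap.IsSymm (energyForm L H Q₁ Q₂) := ⟨fun x x' => by
  simp only [energyForm_apply]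
  rw [inner_apply_comm_of_isPositive hQ₁, inner_apply_comm_of_isPositive hQ₂, RingHom.id_apply]⟩

theorem exists_mul_norm_sq_le_inner_add_inner [CompleteSpace F] [CompleteSpace Y]
    (hQ₁ : (Q₁ : F →L[ℝ] F).IsPositive) (hQ₂ : (Q₂ : Y →L[ℝ] Y).IsPositive) :
    ∃ c : ℝ, 0 < c ∧ (∀ w : WithLp 2 (F × Y), c * ‖w‖ ^ 2 ≤
      inner ℝ (Q₁ w.fst) w.fst + inner ℝ (Q₂ w.snd) w.snd) := by
  obtain ⟨c₁, hc₁, h₁⟩ := Q₁.exists_mul_norm_sq_le_of_isPositive hQ₁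
  obtain ⟨c₂, hc₂, h₂⟩ := Q₂.exists_mul_norm_sq_le_of_isPositive hQ₂
  refine ⟨min c₁ c₂, lt_min hc₁ hc₂, fun w => ?_⟩
  rw [WithLp.prod_norm_sq_eq_of_L2, mul_add]
  refine add_le_add (le_trans ?_ (h₁ _)) (le_trans ?_ (h₂ _))
  · gcongr
    exact min_le_left _ _
  · gcongr
    exact min_le_right _ _

/-- Solvability of the variational equation `B(p, x) = (z, Lx) + (u, Hx)`: the energy form is
induced by a coercive form on the Hilbert space `R([L, H])`, so that Lax–Milgram applies. -/
theorem exists_energyForm_eq [CompleteSpace F] [CompleteSpace Y]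
    (hQ₁ : (Q₁ : F →L[ℝ] F).IsPositive) (hQ₂ : (Q₂ : Y →L[ℝ] Y).IsPositive)
    (h : Assumption2 L H) (z : F) (u : Y) :
    ∃ p : L.domain, ∀ x : L.domain,
      energyForm L H Q₁ Q₂ p x = inner ℝ z (L x) + inner ℝ u (H (x : X)) := by
  have hR : IsClosed (LinearMap.range (jointMap L H).toFun : Set (WithLp 2 (F × Y))) :=
    isClosed_range_jointMap h
  set V := LinearMap.range (jointMap L H).toFun
  have : CompleteSpace V := hR.completeSpace_coe
  let π₁ : V →L[ℝ] F := (WithLp.fstL 2 ℝ F Y).comp V.subtypeL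
  let π₂ : V →L[ℝ] Y := (WithLp.sndL 2 ℝ F Y).comp V.subtypeL
  let B : V →L[ℝ] V →L[ℝ] ℝ :=
    (innerSL ℝ (E := F)).bilinearComp ((Q₁ : F →L[ℝ] F).comp π₁) π₁ +
      (innerSL ℝ (E := Y)).bilinearComp ((Q₂ : Y →L[ℝ] Y).comp π₂) π₂
  have hB (v v' : V) : B v v' = inner ℝ (Q₁ (v : WithLp 2 (F × Y)).fst) (v' : WithLp 2 (F × Y)).fst
      + inner ℝ (Q₂ (v : WithLp 2 (F × Y)).snd) (v' : WithLp 2 (F × Y)).snd := rfl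
  have hcoer : IsCoercive B := by
    obtain ⟨c, hc, hcle⟩ := exists_mul_norm_sq_le_inner_add_inner hQ₁ hQ₂
    refine ⟨c, hc, fun v => ?_⟩
    rw [hB, mul_assoc, ← sq]
    exact hcle v
  let g : StrongDual ℝ V := (innerSL ℝ z).comp π₁ + (innerSL ℝ u).comp π₂
  obtain ⟨p, hp⟩ := (hcoer.continuousLinearEquivOfBilin.symm
    ((InnerProductSpace.toDual ℝ V).symm g)).2
  refine ⟨p, fun x => ?_⟩
  have key := hcoer.continuousLinearEquivOfBilin_apply
    (hcoer.continuousLinearEquivOfBilin.symm ((InnerProductSpace.toDual ℝ V).symm g))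
    ⟨jointMap L H x, x, rfl⟩
  rw [ContinuousLinearEquiv.apply_symm_apply, InnerProductSpace.toDual_symm_apply, hB,
    ← hp] at key
  exact key.symm

end MinimaxEstimation

end

noncomputable section

namespace MinimaxEstimation

/-! ### The Euler systems -/

section Euler

variable {X F Y : Type*}
  [NormedAddCommGroup X] [InnerProductSpace ℝ X] [CompleteSpace X]
  [NormedAddCommGroup F] [InnerProductSpace ℝ F]
  [NormedAddCommGroup Y] [InnerProductSpace ℝ Y] [CompleteSpace Y]
  {L : X →ₗ.[ℝ] F} {H : X →L[ℝ] Y} {Q₁ : F ≃L[ℝ] F} {Q₂ : Y ≃L[ℝ] Y}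

/-- Membership in `R(L*) + R(H*)` means that the functional `ℓ` factors through `[L, H]`. -/
theorem mem_adjointRangeSum_iff (hL : Dense (L.domain : Set X)) {ℓ : X} :
    ℓ ∈ adjointRangeSum L H ↔ ∃ (z : F) (u : Y), ∀ x : L.domain,
      inner ℝ ℓ (x : X) = inner ℝ z (L x) + inner ℝ u (H (x : X)) := by
  constructor
  · intro h
    obtain ⟨_, ⟨z, rfl⟩, _, ⟨u, rfl⟩, rfl⟩ := Submodule.mem_sup.1 h
    refine ⟨z, u, fun x => ?_⟩
    rw [inner_add_left]
    exact congrArg₂ (· + ·) (LinearPMap.adjoint_isFormalAdjoint hL z x)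
      (ContinuousLinearMap.adjoint_inner_left H _ u)
  · rintro ⟨z, u, h⟩
    have hz (x : L.domain) :
        inner ℝ (ℓ - ContinuousLinearMap.adjoint H u) (x : X) = inner ℝ z (L x) := by
      rw [inner_sub_left, h, ContinuousLinearMap.adjoint_inner_left, add_sub_cancel_right]
    have hmem := LinearPMap.mem_adjoint_domain_of_exists z ⟨_, hz⟩
    refine Submodule.mem_sup.2 ⟨_, ⟨⟨z, hmem⟩, rfl⟩, _, ⟨u, rfl⟩, ?_⟩
    change L.adjoint ⟨z, hmem⟩ + ContinuousLinearMap.adjoint H u = ℓ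
    rw [LinearPMap.adjoint_apply_eq hL ⟨z, hmem⟩ hz, sub_add_cancel]

/-- The common weak form of the two Euler systems: `L* (Q₁Lp) = m` in the sense of the adjoint. -/
theorem exists_adjoint_apply_eq_iff (hL : Dense (L.domain : Set X)) (p : L.domain) (m : X) :
    (∃ z : L.adjoint.domain, L.adjoint z = m ∧ L p = Q₁.symm (z : F)) ↔
      ∀ x : L.domain, inner ℝ (Q₁ (L p)) (L x) = inner ℝ m (x : X) := by
  constructor
  · rintro ⟨z, rfl, hp⟩ x
    rw [hp, Q₁.apply_symm_apply]
    exact (LinearPMap.adjoint_isFormalAdjoint hL z x).symm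
  · intro h
    have hmem := LinearPMap.mem_adjoint_domain_of_exists (Q₁ (L p)) ⟨m, fun x => (h x).symm⟩
    exact ⟨⟨_, hmem⟩, LinearPMap.adjoint_apply_eq hL _ fun x => (h x).symm,
      (Q₁.symm_apply_apply _).symm⟩

theorem exists_aPrioriEuler_iff (hL : Dense (L.domain : Set X)) (ℓ : X) (p : L.domain) :
    (∃ z, APrioriEuler L H Q₁ Q₂ ℓ p z) ↔
      ∀ x : L.domain, energyForm L H Q₁ Q₂ p x = inner ℝ ℓ (x : X) := by
  refine (exists_adjoint_apply_eq_iff hL p _).trans (forall_congr' fun x => ?_)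
  rw [inner_sub_left, ContinuousLinearMap.adjoint_inner_left, energyForm_apply,
    eq_sub_iff_add_eq]

theorem exists_aPosterioriEuler_iff (hL : Dense (L.domain : Set X)) (y : Y) (φ : L.domain) :
    (∃ q, APosterioriEuler L H Q₁ Q₂ y φ q) ↔
      ∀ x : L.domain, energyForm L H Q₁ Q₂ φ x = inner ℝ (Q₂ y) (H (x : X)) := by
  refine (exists_adjoint_apply_eq_iff hL φ _).trans (forall_congr' fun x => ?_)
  rw [ContinuousLinearMap.adjoint_inner_left, map_sub, inner_sub_left, energyForm_apply,
    eq_sub_iff_add_eq]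

end Euler

/-! ### The a priori risk -/

section Risk

/-- The mean square of a shifted centred random variable splits into the squared shift and the
variance. -/
theorem lintegral_ofReal_sub_sq {Ω : Type*} [MeasurableSpace Ω] {μ : Measure Ω}
    [IsProbabilityMeasure μ] {f : Ω → ℝ} (hf : AEStronglyMeasurable f μ)
    (hmean : ∫ ω, f ω ∂μ = 0) (hfin : ∫⁻ ω, ENNReal.ofReal (f ω ^ 2) ∂μ < ⊤) (s : ℝ) :
    ∫⁻ ω, ENNReal.ofReal ((s - f ω) ^ 2) ∂μ =
      ENNReal.ofReal (s ^ 2) + ∫⁻ ω, ENNReal.ofReal (f ω ^ 2) ∂μ := by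
  have hsq : Integrable (fun ω => f ω ^ 2) μ := by
    refine ⟨hf.pow 2, ?_⟩
    rw [hasFiniteIntegral_iff_ofReal (Filter.Eventually.of_forall fun _ => sq_nonneg _)]
    exact hfin
  have hf2 : MemLp f 2 μ := (memLp_two_iff_integrable_sq hf).2 hsq
  have hint : Integrable f μ := hf2.integrable one_le_two
  have hs : Integrable (fun ω => (s - f ω) ^ 2) μ := by
    have := (memLp_two_iff_integrable_sq (aestronglyMeasurable_const.sub hf)).1
      ((memLp_const s).sub hf2)
    exact this
  rw [← ofReal_integral_eq_lintegral_ofReal hs (Filter.Eventually.of_forall fun _ => sq_nonneg _),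
    ← ofReal_integral_eq_lintegral_ofReal hsq (Filter.Eventually.of_forall fun _ => sq_nonneg _),
    ← ENNReal.ofReal_add (sq_nonneg _) (integral_nonneg fun _ => sq_nonneg _)]
  congr 1
  have hexp : (fun ω => (s - f ω) ^ 2) = fun ω => (s ^ 2 - 2 * s * f ω) + f ω ^ 2 := by
    ext ω
    ring
  rw [hexp, integral_add (by fun_prop) hsq, integral_sub (by fun_prop) (by fun_prop),
    integral_const_mul, hmean]
  simp

variable {X F Y : Type*}
  [NormedAddCommGroup X] [InnerProductSpace ℝ X]
  [NormedAddCommGroup F] [InnerProductSpace ℝ F]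
  [NormedAddCommGroup Y] [InnerProductSpace ℝ Y] [MeasurableSpace Y] [BorelSpace Y]
  {L : X →ₗ.[ℝ] F} {H : X →L[ℝ] Y} {Q₁ : F ≃L[ℝ] F} {Q₂ : Y ≃L[ℝ] Y}

/-- The law of the random element that takes the values `v` and `-v` with probability `1/2`. -/
def twoPointLaw {Y : Type*} [NormedAddCommGroup Y] [MeasurableSpace Y] (v : Y) : Measure Y :=
  (2⁻¹ : ℝ≥0∞) • (Measure.dirac v + Measure.dirac (-v))

theorem lintegral_twoPointLaw {Y : Type*} [NormedAddCommGroup Y] [MeasurableSpace Y] (v : Y)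
    {f : Y → ℝ≥0∞} (hf : Measurable f) :
    ∫⁻ η, f η ∂(twoPointLaw v) = 2⁻¹ * (f v + f (-v)) := by
  rw [twoPointLaw, lintegral_smul_measure, lintegral_add_measure, lintegral_dirac' _ hf,
    lintegral_dirac' _ hf, smul_eq_mul]

theorem twoPointLaw_mem_noiseLaws {v : Y} (hv : inner ℝ (Q₂ v) v ≤ 1) :
    twoPointLaw v ∈ noiseLaws Q₂ := by
  refine ⟨⟨?_⟩, fun u => ?_, ?_⟩
  · rw [← lintegral_one, lintegral_twoPointLaw v measurable_const]
    rw [one_add_one_eq_two]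
    exact ENNReal.inv_mul_cancel two_ne_zero ENNReal.ofNat_ne_top
  · have hm : StronglyMeasurable fun η : Y => (inner ℝ u η : ℝ) :=
      (by fun_prop : Continuous fun η : Y => (inner ℝ u η : ℝ)).measurable.stronglyMeasurable
    have hi (w : Y) : Integrable (fun η : Y => (inner ℝ u η : ℝ)) (Measure.dirac w) :=
      integrable_dirac' hm (by simp)
    rw [twoPointLaw, integral_smul_measure, integral_add_measure (hi _) (hi _),
      integral_dirac' _ _ hm, integral_dirac' _ _ hm]
    simp
  · have hm : Measurable fun η : Y => ENNReal.ofReal (inner ℝ (Q₂ η) η) :=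
      (by fun_prop : Continuous fun η : Y => (inner ℝ (Q₂ η) η : ℝ)).measurable.ennreal_ofReal
    rw [lintegral_twoPointLaw v hm]
    simp only [map_neg, inner_neg_left, inner_neg_right, neg_neg]
    rw [← two_mul, ← mul_assoc, ENNReal.inv_mul_cancel two_ne_zero ENNReal.ofNat_ne_top, one_mul]
    exact ENNReal.ofReal_le_one.2 hv

/-- Every affine estimate has risk at least its squared bias plus its noise variance at admissible
data: for one of the two signs of `x` the constant `c` does not decrease the squared bias, and the
noise takes the values `v` and `-v`. -/
theorem ofReal_add_sq_le_aPrioriRisk (ℓ : X) (u : Y) (c : ℝ) {x : L.domain} {v : Y}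
    (hx : inner ℝ (Q₁ (L x)) (L x) ≤ 1) (hv : inner ℝ (Q₂ v) v ≤ 1) :
    ENNReal.ofReal ((inner ℝ ℓ (x : X) - inner ℝ u (H (x : X))) ^ 2 + inner ℝ u v ^ 2) ≤
      aPrioriRisk L H Q₁ Q₂ ℓ u c := by
  have main (x : L.domain) (hx : inner ℝ (Q₁ (L x)) (L x) ≤ 1) :
      ENNReal.ofReal ((inner ℝ ℓ (x : X) - inner ℝ u (H (x : X)) - c) ^ 2 + inner ℝ u v ^ 2) ≤
        aPrioriRisk L H Q₁ Q₂ ℓ u c := by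
    refine le_trans ?_ (le_iSup₂_of_le x hx (le_iSup₂_of_le (twoPointLaw v)
      (twoPointLaw_mem_noiseLaws hv) le_rfl))
    rw [lintegral_twoPointLaw v (Continuous.measurable (by fun_prop)).ennreal_ofReal,
      ← ENNReal.ofReal_add (sq_nonneg _) (sq_nonneg _),
      show (2⁻¹ : ℝ≥0∞) = ENNReal.ofReal 2⁻¹ by
        rw [ENNReal.ofReal_inv_of_pos two_pos, ENNReal.ofReal_ofNat],
      ← ENNReal.ofReal_mul (by norm_num)]
    refine ENNReal.ofReal_le_ofReal (le_of_eq ?_)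
    simp only [inner_add_right, inner_neg_right]
    ring
  rcases le_total 0 ((inner ℝ ℓ (x : X) - inner ℝ u (H (x : X))) * c) with h | h
  · refine le_trans (ENNReal.ofReal_le_ofReal ?_) (main (-x) (by simpa [L.map_neg] using hx))
    simp only [Submodule.coe_neg, map_neg, inner_neg_right]
    nlinarith [sq_nonneg c]
  · refine le_trans (ENNReal.ofReal_le_ofReal ?_) (main x hx)
    nlinarith [sq_nonneg c]

/-- The a priori error is bounded below by the energy of the solution `p` of `B(p, ·) = ℓ`. The
least favourable data are `x = p / √a` and `v = Hp / √b` with `a = (Q₁Lp, Lp)`,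
`b = (Q₂Hp, Hp)`. -/
theorem ofReal_energyForm_le_aPrioriRisk (hQ₁ : (Q₁ : F →L[ℝ] F).IsPositive)
    (hQ₂ : (Q₂ : Y →L[ℝ] Y).IsPositive) {ℓ : X} {p : L.domain}
    (hp : ∀ x : L.domain, energyForm L H Q₁ Q₂ p x = inner ℝ ℓ (x : X)) (u : Y) (c : ℝ) :
    ENNReal.ofReal (energyForm L H Q₁ Q₂ p p) ≤ aPrioriRisk L H Q₁ Q₂ ℓ u c := by
  by_cases htop : aPrioriRisk L H Q₁ Q₂ ℓ u c = ⊤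
  · simp [htop]
  set R := (aPrioriRisk L H Q₁ Q₂ ℓ u c).toReal with hR
  have ha : 0 ≤ inner ℝ (Q₁ (L p)) (L p) := hQ₁.inner_nonneg_left _
  have hb : 0 ≤ inner ℝ (Q₂ (H (p : X))) (H (p : X)) := hQ₂.inner_nonneg_left _
  have hE : energyForm L H Q₁ Q₂ p p = inner ℝ (Q₁ (L p)) (L p) +
    inner ℝ (Q₂ (H (p : X))) (H (p : X)) := energyForm_apply p p
  have hℓp := hp p
  set a := inner ℝ (Q₁ (L p)) (L p)
  set b := inner ℝ (Q₂ (H (p : X))) (H (p : X))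
  set t := inner ℝ u (H (p : X))
  refine ENNReal.ofReal_le_of_le_toReal ?_
  rw [hE] at hℓp ⊢
  -- A small `ε > 0` in the normalization covers the degenerate cases `a = 0` and `b = 0`.
  have key (ε : ℝ) (hε : 0 < ε) : (a + b) ^ 2 ≤ R * (a + b + 2 * ε) := by
    have hα : 0 < a + ε := by linarith
    have hβ : 0 < b + ε := by linarith
    have h := ofReal_add_sq_le_aPrioriRisk (H := H) (Q₁ := Q₁) (Q₂ := Q₂) ℓ u c
      (x := (√(a + ε))⁻¹ • p) (v := (√(b + ε))⁻¹ • H (p : X))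
      (by
        rw [L.map_smul, map_smul, real_inner_smul_left, real_inner_smul_right, ← mul_assoc,
          ← mul_inv, Real.mul_self_sqrt hα.le, inv_mul_le_iff₀ hα]
        change a ≤ _
        linarith)
      (by
        rw [map_smul, real_inner_smul_left, real_inner_smul_right, ← mul_assoc,
          ← mul_inv, Real.mul_self_sqrt hβ.le, inv_mul_le_iff₀ hβ]
        change b ≤ _
        linarith)
    rw [ENNReal.ofReal_le_iff_le_toReal htop, ← hR] at h
    simp only [Submodule.coe_smul, map_smul, real_inner_smul_right] at h
    rw [← hℓp, ← mul_sub, mul_pow, mul_pow, inv_pow, inv_pow, Real.sq_sqrt hα.le,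
      Real.sq_sqrt hβ.le] at h
    change (a + ε)⁻¹ * (a + b - t) ^ 2 + (b + ε)⁻¹ * t ^ 2 ≤ R at h
    calc (a + b) ^ 2 = ((a + b - t) + t) ^ 2 := by ring
      _ ≤ ((a + b - t) ^ 2 / (a + ε) + t ^ 2 / (b + ε)) * ((a + ε) + (b + ε)) := by
        rw [← div_le_iff₀ (by linarith)]
        have : (a + b - t) ^ 2 / (a + ε) + t ^ 2 / (b + ε) -
              (a + b - t + t) ^ 2 / (a + ε + (b + ε)) =
            ((a + b - t) * (b + ε) - t * (a + ε)) ^ 2 /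
              ((a + ε) * (b + ε) * (a + ε + (b + ε))) := by
          field_simp
          ring
        rw [← sub_nonneg, this]
        positivity
      _ ≤ R * ((a + ε) + (b + ε)) := by
        gcongr
        simpa only [div_eq_inv_mul] using h
      _ = R * (a + b + 2 * ε) := by ring
  have hR0 : 0 ≤ R := ENNReal.toReal_nonneg
  have hlim : (a + b) ^ 2 ≤ R * (a + b) := by
    refine le_of_forall_pos_le_add fun δ hδ => ?_
    refine (key (δ / (2 * (R + 1))) (by positivity)).trans ?_
    have : R * (2 * (δ / (2 * (R + 1)))) ≤ δ := by
      rw [mul_div_assoc', mul_div_assoc', div_le_iff₀ (by positivity)]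
      nlinarith
    linarith
  rcases (add_nonneg ha hb).eq_or_lt with h0 | h0
  · rw [← h0]
    exact hR0
  · exact le_of_mul_le_mul_right (by linarith) h0

/-- The estimate `(Q₂Hp, y)` has risk at most the energy of `p`. -/
theorem aPrioriRisk_le_ofReal_energyForm (hQ₁ : (Q₁ : F →L[ℝ] F).IsPositive)
    (hQ₂ : (Q₂ : Y →L[ℝ] Y).IsPositive) {ℓ : X} {p : L.domain}
    (hp : ∀ x : L.domain, energyForm L H Q₁ Q₂ p x = inner ℝ ℓ (x : X)) :
    aPrioriRisk L H Q₁ Q₂ ℓ (Q₂ (H (p : X))) 0 ≤ ENNReal.ofReal (energyForm L H Q₁ Q₂ p p) := by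
  refine iSup₂_le fun x hx => iSup₂_le fun μ hμ => ?_
  obtain ⟨hprob, hmean, hcov⟩ := hμ
  set u := Q₂ (H (p : X)) with hu
  have ha : 0 ≤ inner ℝ (Q₁ (L p)) (L p) := hQ₁.inner_nonneg_left _
  have hb : 0 ≤ inner ℝ u (H (p : X)) := hQ₂.inner_nonneg_left _
  have hvar : ∫⁻ η, ENNReal.ofReal (inner ℝ u η ^ 2) ∂μ ≤
      ENNReal.ofReal (inner ℝ u (H (p : X))) := by
    calc ∫⁻ η, ENNReal.ofReal (inner ℝ u η ^ 2) ∂μ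
        ≤ ∫⁻ η, ENNReal.ofReal (inner ℝ u (H (p : X))) * ENNReal.ofReal (inner ℝ (Q₂ η) η) ∂μ := by
          refine lintegral_mono fun η => ?_
          rw [← ENNReal.ofReal_mul hb]
          exact ENNReal.ofReal_le_ofReal (inner_apply_sq_le_of_isPositive hQ₂ _ _)
      _ = ENNReal.ofReal (inner ℝ u (H (p : X))) *
            ∫⁻ η, ENNReal.ofReal (inner ℝ (Q₂ η) η) ∂μ :=
          lintegral_const_mul' _ _ ENNReal.ofReal_ne_top
      _ ≤ ENNReal.ofReal (inner ℝ u (H (p : X))) := mul_le_of_le_one_right' hcov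
  have hbias : inner ℝ ℓ (x : X) - inner ℝ u (H (x : X)) = inner ℝ (Q₁ (L p)) (L x) := by
    rw [← hp, energyForm_apply, add_sub_cancel_right]
  have hint (η : Y) : inner ℝ ℓ (x : X) - (inner ℝ u (H (x : X) + η) + 0) =
      inner ℝ (Q₁ (L p)) (L x) - inner ℝ u η := by
    rw [inner_add_right, ← hbias]
    ring
  simp only [hint]
  rw [lintegral_ofReal_sub_sq (Continuous.measurable (by fun_prop)).aestronglyMeasurable (hmean u)
    (hvar.trans_lt ENNReal.ofReal_lt_top), energyForm_apply, ← hu,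
    ENNReal.ofReal_add ha hb]
  refine add_le_add (ENNReal.ofReal_le_ofReal ?_) hvar
  exact (inner_apply_sq_le_of_isPositive hQ₁ _ _).trans
    (mul_le_of_le_one_right ha hx)

theorem aPrioriError_eq_ofReal_sqrt_energyForm (hQ₁ : (Q₁ : F →L[ℝ] F).IsPositive)
    (hQ₂ : (Q₂ : Y →L[ℝ] Y).IsPositive) {ℓ : X} {p : L.domain}
    (hp : ∀ x : L.domain, energyForm L H Q₁ Q₂ p x = inner ℝ ℓ (x : X)) :
    aPrioriError L H Q₁ Q₂ ℓ = ENNReal.ofReal √(energyForm L H Q₁ Q₂ p p) := by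
  have : ⨅ (u : Y) (c : ℝ), aPrioriRisk L H Q₁ Q₂ ℓ u c =
      ENNReal.ofReal (energyForm L H Q₁ Q₂ p p) :=
    le_antisymm (iInf₂_le_of_le _ _ (aPrioriRisk_le_ofReal_energyForm hQ₁ hQ₂ hp))
      (le_iInf₂ (ofReal_energyForm_le_aPrioriRisk hQ₁ hQ₂ hp))
  rw [aPrioriError, this, ENNReal.ofReal_rpow_of_nonneg (energyForm_nonneg hQ₁ hQ₂ p)
    (by norm_num), Real.sqrt_eq_rpow]

end Risk

end MinimaxEstimation

end

noncomputable section

namespace MinimaxEstimation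

/-! ### Directional radii of ellipsoids -/

section Ellipsoid

variable {X : Type*} [NormedAddCommGroup X] [InnerProductSpace ℝ X]
  {D : Submodule ℝ X} {B : LinearMap.BilinForm ℝ D} {φ ℓ : X} {b : ℝ} {p : D}

/-- The set of all `φ + d` with `d ∈ D` and `B(d, d) ≤ b`, for a quadratic form `B` on a subspace
`D`. It is unbounded if `B` is degenerate. -/
def ellipsoid (B : LinearMap.BilinForm ℝ D) (φ : X) (b : ℝ) : Set X :=
  {ψ | ∃ d : D, φ + d = ψ ∧ B d d ≤ b}

theorem center_mem_ellipsoid (hb : 0 ≤ b) : φ ∈ ellipsoid B φ b := ⟨0, by simp, by simpa using hb⟩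

theorem mem_ellipsoid_reflection {x : X} (hx : x ∈ ellipsoid B φ b) :
    φ + φ - x ∈ ellipsoid B φ b := by
  obtain ⟨d, rfl, hd⟩ := hx
  refine ⟨-d, ?_, by simpa using hd⟩
  rw [Submodule.coe_neg]
  abel

theorem abs_apply_le_sqrt_mul_sqrt (hB : ∀ d, 0 ≤ B d d) (hsymm : LinearMap.IsSymm B)
    (p : D) {d : D} (hd : B d d ≤ b) : |B p d| ≤ √b * √(B p p) := by
  rw [← Real.sqrt_sq_eq_abs, mul_comm, ← Real.sqrt_mul (hB p)]
  exact Real.sqrt_le_sqrt ((LinearMap.BilinForm.apply_sq_le_of_symm B hB hsymm p d).trans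
    (mul_le_mul_of_nonneg_left hd (hB p)))

/-- The Cauchy–Schwarz bound is attained on the ellipsoid, also if `B(p, p) = 0`. -/
theorem exists_apply_eq_sqrt_mul_sqrt (hB : ∀ d, 0 ≤ B d d) (hb : 0 ≤ b) (p : D) :
    ∃ d : D, B d d ≤ b ∧ B p d = √b * √(B p p) := by
  refine ⟨(√b / √(B p p)) • p, ?_, ?_⟩ <;>
    simp only [map_smul, LinearMap.smul_apply, smul_eq_mul]
  · rcases (hB p).eq_or_lt with h | h
    · simpa [← h] using hb
    · refine le_of_eq ?_
      rw [← mul_assoc, ← sq, div_pow, Real.sq_sqrt hb, Real.sq_sqrt h.le, div_mul_cancel₀ _ h.ne']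
  · rw [div_mul_eq_mul_div, mul_div_assoc, Real.div_sqrt]

/-- If the directional error is finite, the direction is orthogonal to the null space of the
quadratic form, as the set contains the lines `φ + t d` for `d` in this null space. -/
theorem inner_eq_zero_of_aPosterioriError_lt_top (hb : 0 ≤ b)
    (h : aPosterioriError (ellipsoid B φ b) ℓ < ⊤) {d : D} (hd : B d d = 0) :
    inner ℝ ℓ (d : X) = 0 := by
  obtain ⟨φ', h⟩ := iInf_lt_iff.1 h
  obtain ⟨-, h⟩ := iInf_lt_iff.1 h
  set R := (directionalRadiusAt (ellipsoid B φ b) ℓ φ').toReal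
  have hbound (t : ℝ) : |inner ℝ ℓ φ' - (inner ℝ ℓ φ + t * inner ℝ ℓ (d : X))| ≤ R := by
    rw [← ENNReal.ofReal_le_iff_le_toReal h.ne]
    have hmem : φ + (t • d : D) ∈ ellipsoid B φ b := ⟨t • d, rfl, by simpa [hd] using hb⟩
    refine le_iSup₂_of_le _ hmem (le_of_eq ?_)
    rw [inner_add_right, Submodule.coe_smul, real_inner_smul_right]
  by_contra hne
  have h1 := hbound ((inner ℝ ℓ φ' - inner ℝ ℓ φ + (R + 1)) / inner ℝ ℓ (d : X))
  rw [div_mul_cancel₀ _ hne, abs_le] at h1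
  linarith [h1.1]

theorem directionalRadiusAt_ellipsoid_center (hB : ∀ d, 0 ≤ B d d) (hsymm : LinearMap.IsSymm B)
    (hb : 0 ≤ b) (hp : ∀ d : D, B p d = inner ℝ ℓ (d : X)) :
    directionalRadiusAt (ellipsoid B φ b) ℓ φ = ENNReal.ofReal (√b * √(B p p)) := by
  refine le_antisymm (iSup₂_le ?_) ?_
  · rintro _ ⟨d, rfl, hd⟩
    refine ENNReal.ofReal_le_ofReal ?_
    rw [inner_add_right, ← hp, sub_add_cancel_left, abs_neg]
    exact abs_apply_le_sqrt_mul_sqrt hB hsymm p hd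
  · obtain ⟨d, hd, hpd⟩ := exists_apply_eq_sqrt_mul_sqrt hB hb p
    refine le_iSup₂_of_le (φ + d) ⟨d, rfl, hd⟩ (ENNReal.ofReal_le_ofReal ?_)
    rw [inner_add_right, ← hp, sub_add_cancel_left, abs_neg, hpd]
    exact le_abs_self _

theorem aPosterioriError_ellipsoid (hB : ∀ d, 0 ≤ B d d) (hsymm : LinearMap.IsSymm B)
    (hb : 0 ≤ b) (hp : ∀ d : D, B p d = inner ℝ ℓ (d : X)) :
    aPosterioriError (ellipsoid B φ b) ℓ = ENNReal.ofReal (√b * √(B p p)) := by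
  refine le_antisymm ((iInf₂_le φ (center_mem_ellipsoid hb)).trans_eq
    (directionalRadiusAt_ellipsoid_center hB hsymm hb hp)) (le_iInf₂ fun φ' _ => ?_)
  obtain ⟨d, hd, hpd⟩ := exists_apply_eq_sqrt_mul_sqrt hB hb p
  -- Of the two opposite extreme points one is at least as far from `φ'` as from the centre.
  rcases le_total (inner ℝ ℓ φ' : ℝ) (inner ℝ ℓ φ) with h | h
  · refine le_iSup₂_of_le (φ + d) ⟨d, rfl, hd⟩ (ENNReal.ofReal_le_ofReal ?_)
    rw [inner_add_right, ← hp, hpd, abs_sub_comm]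
    exact le_trans (by linarith) (le_abs_self _)
  · refine le_iSup₂_of_le (φ + (-d : D)) ⟨-d, rfl, by simpa using hd⟩
      (ENNReal.ofReal_le_ofReal ?_)
    rw [inner_add_right, ← hp, map_neg, hpd]
    exact le_trans (by linarith) (le_abs_self _)

theorem isAPosterioriEstimation_ellipsoid (hB : ∀ d, 0 ≤ B d d) (hsymm : LinearMap.IsSymm B)
    (hb : 0 ≤ b) (hp : ∀ d : D, B p d = inner ℝ ℓ (d : X)) :
    IsAPosterioriEstimation (ellipsoid B φ b) ℓ (inner ℝ ℓ φ) := by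
  obtain ⟨d, hd, hpd⟩ := exists_apply_eq_sqrt_mul_sqrt hB hb p
  refine ⟨inner ℝ ℓ φ - √b * √(B p p), inner ℝ ℓ φ + √b * √(B p p), IsLeast.isGLB ⟨?_, ?_⟩,
    IsGreatest.isLUB ⟨?_, ?_⟩, by ring⟩
  · refine ⟨φ + (-d : D), ⟨-d, rfl, by simpa using hd⟩, ?_⟩
    simp only [inner_add_right, ← hp, map_neg, hpd, sub_eq_add_neg]
  · rintro _ ⟨_, ⟨d', rfl, hd'⟩, rfl⟩
    have := (abs_le.1 (abs_apply_le_sqrt_mul_sqrt hB hsymm p hd')).1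
    simp only [inner_add_right, ← hp]
    linarith
  · refine ⟨φ + d, ⟨d, rfl, hd⟩, ?_⟩
    simp only [inner_add_right, ← hp, hpd]
  · rintro _ ⟨_, ⟨d', rfl, hd'⟩, rfl⟩
    have := (abs_le.1 (abs_apply_le_sqrt_mul_sqrt hB hsymm p hd')).2
    simp only [inner_add_right, ← hp]
    linarith

end Ellipsoid

/-! ### Chebyshev centres -/

section Chebyshev

variable {X : Type*} [NormedAddCommGroup X] [InnerProductSpace ℝ X] {G : Set X} {φ ψ : X}

/-- The radius is the supremum of the directional radii over the unit sphere, because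
`‖v‖ = sup (ℓ, v)` over unit vectors `ℓ`. -/
theorem iSup_directionalRadiusAt_eq_radiusAt (G : Set X) (φ : X) :
    ⨆ (ℓ : X) (_ : ‖ℓ‖ = 1), directionalRadiusAt G ℓ φ = radiusAt G φ := by
  refine le_antisymm (iSup₂_le fun ℓ hℓ => iSup₂_le fun x hx => le_iSup₂_of_le x hx
    (ENNReal.ofReal_le_ofReal ?_)) (iSup₂_le fun x hx => ?_)
  · rw [← inner_sub_right]
    simpa [hℓ] using abs_real_inner_le_norm ℓ (φ - x)
  · rcases eq_or_ne (φ - x) 0 with h | h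
    · simp [h]
    · have hn : ‖φ - x‖ ≠ 0 := norm_ne_zero_iff.2 h
      refine le_iSup₂_of_le (‖φ - x‖⁻¹ • (φ - x)) (by simp [norm_smul, hn])
        (le_iSup₂_of_le x hx (ENNReal.ofReal_le_ofReal ?_))
      rw [← inner_sub_right, real_inner_smul_left, real_inner_self_eq_norm_sq, sq,
        inv_mul_cancel_left₀ hn]
      exact le_abs_self _

/-- For a set symmetric about `φ`, moving the centre to `ψ` increases the squared radius by at
least `‖ψ - φ‖²`, by the parallelogram law for `x` and its reflection. -/
theorem radiusAt_le_ofReal_sqrt (hsymm : ∀ x ∈ G, φ + φ - x ∈ G) {R : ℝ} (hR : 0 ≤ R)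
    (h : radiusAt G ψ ≤ ENNReal.ofReal R) :
    radiusAt G φ ≤ ENNReal.ofReal √(R ^ 2 - ‖ψ - φ‖ ^ 2) := by
  have hx (x : X) (hx : x ∈ G) : ‖ψ - x‖ ≤ R :=
    (ENNReal.ofReal_le_ofReal_iff hR).1 ((le_iSup₂_of_le x hx le_rfl).trans h)
  refine iSup₂_le fun x hxG => ENNReal.ofReal_le_ofReal (Real.le_sqrt_of_sq_le ?_)
  have h₁ := pow_le_pow_left₀ (norm_nonneg _) (hx x hxG) 2
  have h₂ := pow_le_pow_left₀ (norm_nonneg _) (hx _ (hsymm x hxG)) 2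
  have hpar := parallelogram_law_with_norm ℝ (ψ - φ) (φ - x)
  rw [show ψ - φ + (φ - x) = ψ - x by abel, show ψ - φ - (φ - x) = ψ - (φ + φ - x) by abel] at hpar
  nlinarith

theorem radiusAt_le_of_symmetric (hsymm : ∀ x ∈ G, φ + φ - x ∈ G) (ψ : X) :
    radiusAt G φ ≤ radiusAt G ψ := by
  by_cases h : radiusAt G ψ = ⊤
  · simp [h]
  · refine (radiusAt_le_ofReal_sqrt hsymm ENNReal.toReal_nonneg
      (ENNReal.ofReal_toReal h).ge).trans (ENNReal.ofReal_le_of_le_toReal ?_)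
    refine Real.sqrt_le_iff.2 ⟨ENNReal.toReal_nonneg, ?_⟩
    linarith [sq_nonneg ‖ψ - φ‖]

theorem eq_of_radiusAt_eq_of_symmetric (hsymm : ∀ x ∈ G, φ + φ - x ∈ G) (hφ : φ ∈ G)
    (hfin : radiusAt G φ < ⊤) (h : radiusAt G ψ = radiusAt G φ) : ψ = φ := by
  have hle := (h.trans (ENNReal.ofReal_toReal hfin.ne).symm).le
  have hsqrt := radiusAt_le_ofReal_sqrt hsymm (ψ := ψ) ENNReal.toReal_nonneg hle
  set R := (radiusAt G φ).toReal
  have hR : 0 ≤ R := ENNReal.toReal_nonneg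
  have hdist : ‖ψ - φ‖ ≤ R :=
    (ENNReal.ofReal_le_ofReal_iff hR).1 ((le_iSup₂_of_le φ hφ le_rfl).trans hle)
  rw [← ENNReal.ofReal_toReal hfin.ne, ENNReal.ofReal_le_ofReal_iff (Real.sqrt_nonneg _),
    Real.le_sqrt hR (sub_nonneg.2 (pow_le_pow_left₀ (norm_nonneg _) hdist 2))] at hsqrt
  rw [← sub_eq_zero, ← norm_eq_zero]
  exact pow_eq_zero_iff two_ne_zero |>.1 (le_antisymm (by linarith) (sq_nonneg _))

end Chebyshev

/-! ### The a posteriori set -/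

section APosteriori

variable {X F Y : Type*}
  [NormedAddCommGroup X] [InnerProductSpace ℝ X]
  [NormedAddCommGroup F] [InnerProductSpace ℝ F]
  [NormedAddCommGroup Y] [InnerProductSpace ℝ Y]
  {L : X →ₗ.[ℝ] F} {H : X →L[ℝ] Y} {Q₁ : F ≃L[ℝ] F} {Q₂ : Y ≃L[ℝ] Y} {y : Y} {φ : L.domain}

/-- The a posteriori set is an ellipsoid of the energy form, centred at a solution `φ` of the
a posteriori Euler system: the linear term vanishes there. -/
theorem aPosterioriSet_eq_ellipsoid (hQ₁ : (Q₁ : F →L[ℝ] F).IsPositive)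
    (hQ₂ : (Q₂ : Y →L[ℝ] Y).IsPositive)
    (hφ : ∀ x : L.domain, energyForm L H Q₁ Q₂ φ x = inner ℝ (Q₂ y) (H (x : X))) :
    aPosterioriSet L H Q₁ Q₂ y =
      ellipsoid (energyForm L H Q₁ Q₂) (φ : X) (1 - inner ℝ (Q₂ y) (y - H (φ : X))) := by
  have key (d : L.domain) : inner ℝ (Q₁ (L (φ + d))) (L (φ + d)) +
      inner ℝ (Q₂ (y - H ((φ + d : L.domain) : X))) (y - H ((φ + d : L.domain) : X)) =
      energyForm L H Q₁ Q₂ d d + inner ℝ (Q₂ y) (y - H (φ : X)) := by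
    have h₁ := hφ φ
    have h₂ := hφ d
    have c₁ := inner_apply_comm_of_isPositive hQ₁ (L d) (L φ)
    have c₂ := inner_apply_comm_of_isPositive hQ₂ (H (φ : X)) y
    have c₃ := inner_apply_comm_of_isPositive hQ₂ (H (d : X)) y
    have c₄ := inner_apply_comm_of_isPositive hQ₂ (H (d : X)) (H (φ : X))
    rw [energyForm_apply] at h₁ h₂ ⊢
    simp only [L.map_add, Submodule.coe_add, map_add, map_sub, inner_add_left, inner_add_right,
      inner_sub_left, inner_sub_right]
    linarith
  ext ψ
  constructor
  · rintro ⟨x, rfl, hx⟩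
    refine ⟨x - φ, by simp, ?_⟩
    have := key (x - φ)
    rw [add_sub_cancel] at this
    linarith [show inner ℝ (Q₁ (L x)) (L x) +
      inner ℝ (Q₂ (y - H (x : X))) (y - H (x : X)) ≤ 1 from hx]
  · rintro ⟨d, rfl, hd⟩
    refine ⟨φ + d, rfl, ?_⟩
    change inner ℝ (Q₁ (L (φ + d))) (L (φ + d)) +
      inner ℝ (Q₂ (y - H ((φ + d : L.domain) : X))) (y - H ((φ + d : L.domain) : X)) ≤ 1
    linarith [key d]

/-- If every directional error is finite, then `[L, H]` is injective, hence bounded below by the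
open mapping theorem, and the a posteriori ellipsoid is bounded. -/
theorem radiusAt_ellipsoid_energyForm_lt_top [CompleteSpace X] [CompleteSpace F] [CompleteSpace Y]
    (hL : L.IsClosed) (hA : Assumption2 L H) (hQ₁ : (Q₁ : F →L[ℝ] F).IsPositive)
    (hQ₂ : (Q₂ : Y →L[ℝ] Y).IsPositive) {c : X} {b : ℝ} (hb : 0 ≤ b)
    (hfin : ∀ ℓ : X, aPosterioriError (ellipsoid (energyForm L H Q₁ Q₂) c b) ℓ < ⊤) :
    radiusAt (ellipsoid (energyForm L H Q₁ Q₂) c b) c < ⊤ := by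
  obtain ⟨C, hC, hpre⟩ := exists_norm_le_norm_jointMap hL hA
  obtain ⟨m, hm, hcoer⟩ := exists_mul_norm_sq_le_inner_add_inner hQ₁ hQ₂
  refine lt_of_le_of_lt (iSup₂_le ?_) (ENNReal.ofReal_lt_top (r := C * √(b / m)))
  rintro _ ⟨d, rfl, hd⟩
  refine ENNReal.ofReal_le_ofReal ?_
  rw [sub_add_cancel_left, norm_neg]
  obtain ⟨d', hLd, hHd, hle⟩ := hpre d
  have hL0 : L (d - d') = 0 := by rw [L.map_sub, hLd, sub_self]
  have hH0 : H ((d - d' : L.domain) : X) = 0 := by rw [Submodule.coe_sub, map_sub, hHd, sub_self]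
  have h0 := inner_eq_zero_of_aPosterioriError_lt_top hb (hfin ((d - d' : L.domain) : X))
    (d := d - d') (by rw [energyForm_apply, hL0, hH0, inner_zero_right, inner_zero_right, add_zero])
  rw [inner_self_eq_zero, Submodule.coe_sub, sub_eq_zero] at h0
  rw [h0]
  refine hle.trans (mul_le_mul_of_nonneg_left (Real.le_sqrt_of_sq_le ?_) hC.le)
  rw [le_div_iff₀ hm, mul_comm]
  exact (hcoer _).trans hd

end APosteriori

end MinimaxEstimation

end

open MinimaxEstimation in
theorem theorem3 {X F Y : Type*}
    [NormedAddCommGroup X] [InnerProductSpace ℝ X] [CompleteSpace X]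
    [NormedAddCommGroup F] [InnerProductSpace ℝ F] [CompleteSpace F]
    [NormedAddCommGroup Y] [InnerProductSpace ℝ Y] [CompleteSpace Y]
    [MeasurableSpace Y] [BorelSpace Y]
    (L : X →ₗ.[ℝ] F) (hLdense : Dense (L.domain : Set X)) (hLclosed : L.IsClosed)
    (H : X →L[ℝ] Y)
    (Q₁ : F ≃L[ℝ] F) (hQ₁ : (Q₁ : F →L[ℝ] F).IsPositive)
    (Q₂ : Y ≃L[ℝ] Y) (hQ₂ : (Q₂ : Y →L[ℝ] Y).IsPositive)
    (hA : Assumption1 L H ∨ Assumption2 L H)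
    (y : Y) (G : Set X) (hG : G = aPosterioriSet L H Q₁ Q₂ y) (hne : G.Nonempty) :
    -- finiteness of the a posteriori error
    (∀ ℓ : X, aPosterioriError G ℓ < ⊤ ↔ ℓ ∈ adjointRangeSum L H) ∧
    -- solvability of the Euler systems; the second one yields the a priori estimation
    (∃ (φ : L.domain) (q : L.adjoint.domain), APosterioriEuler L H Q₁ Q₂ y φ q) ∧
    (∀ ℓ ∈ adjointRangeSum L H,
      (∃ (p : L.domain) (z : L.adjoint.domain), APrioriEuler L H Q₁ Q₂ ℓ p z) ∧
      ∀ (p : L.domain) (z : L.adjoint.domain), APrioriEuler L H Q₁ Q₂ ℓ p z →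
        IsAPrioriEstimation L H Q₁ Q₂ ℓ (Q₂ (H (p : X))) 0) ∧
    -- every solution of the a posteriori Euler system is optimal
    (∀ (φ : L.domain) (q : L.adjoint.domain), APosterioriEuler L H Q₁ Q₂ y φ q →
      (φ : X) ∈ G ∧
      0 ≤ 1 - inner ℝ (Q₂ y) (y - H (φ : X)) ∧
      (∀ ℓ ∈ adjointRangeSum L H,
        aPosterioriError G ℓ =
          ENNReal.ofReal (√(1 - inner ℝ (Q₂ y) (y - H (φ : X)))) * aPrioriError L H Q₁ Q₂ ℓ ∧
        directionalRadiusAt G ℓ (φ : X) = aPosterioriError G ℓ ∧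
        IsAPosterioriEstimation G ℓ (inner ℝ ℓ (φ : X)) ∧
        (∀ (p : L.domain) (z : L.adjoint.domain), APrioriEuler L H Q₁ Q₂ ℓ p z →
          inner ℝ ℓ (φ : X) = inner ℝ (Q₂ (H (p : X))) y)) ∧
      -- the Chebyshev center
      ((∀ ℓ : X, aPosterioriError G ℓ < ⊤) →
        (⨅ ψ ∈ G, radiusAt G ψ) = radiusAt G (φ : X) ∧
        radiusAt G (φ : X) =
          ENNReal.ofReal (√(1 - inner ℝ (Q₂ y) (y - H (φ : X)))) *
            (⨆ (ℓ : X) (_ : ‖ℓ‖ = 1), aPrioriError L H Q₁ Q₂ ℓ) ∧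
        radiusAt G (φ : X) < ⊤ ∧
        ∀ ψ ∈ G, radiusAt G ψ = radiusAt G (φ : X) → ψ = (φ : X))) := by
  have hA₂ : Assumption2 L H := hA.elim (Assumption1.assumption2 hLclosed) id
  have hB := energyForm_nonneg (L := L) (H := H) hQ₁ hQ₂
  have hsymm := energyForm_isSymm (L := L) (H := H) hQ₁ hQ₂
  obtain ⟨φ₀, hφ₀⟩ := exists_energyForm_eq hQ₁ hQ₂ hA₂ (0 : F) (Q₂ y)
  replace hφ₀ : ∀ x : L.domain, energyForm L H Q₁ Q₂ φ₀ x = inner ℝ (Q₂ y) (H (x : X)) :=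
    fun x => by rw [hφ₀, inner_zero_left, zero_add]
  have hE (φ : L.domain)
      (hφ : ∀ x : L.domain, energyForm L H Q₁ Q₂ φ x = inner ℝ (Q₂ y) (H (x : X))) :
      G = ellipsoid (energyForm L H Q₁ Q₂) (φ : X) (1 - inner ℝ (Q₂ y) (y - H (φ : X))) ∧
        0 ≤ 1 - inner ℝ (Q₂ y) (y - H (φ : X)) := by
    have h := hG.trans (aPosterioriSet_eq_ellipsoid hQ₁ hQ₂ hφ)
    refine ⟨h, ?_⟩
    obtain ⟨ψ, hψ⟩ := hne
    rw [h] at hψ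
    obtain ⟨d, -, hd⟩ := hψ
    exact (hB d).trans hd
  have hsolve (ℓ : X) (hℓ : ℓ ∈ adjointRangeSum L H) :
      ∃ p : L.domain, ∀ x : L.domain, energyForm L H Q₁ Q₂ p x = inner ℝ ℓ (x : X) := by
    obtain ⟨z, u, h⟩ := (mem_adjointRangeSum_iff hLdense).1 hℓ
    obtain ⟨p, hp⟩ := exists_energyForm_eq hQ₁ hQ₂ hA₂ z u
    exact ⟨p, fun x => (hp x).trans (h x).symm⟩
  have hfinite (ℓ : X) : aPosterioriError G ℓ < ⊤ ↔ ℓ ∈ adjointRangeSum L H := by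
    obtain ⟨hGE, hb⟩ := hE φ₀ hφ₀
    rw [hGE]
    constructor
    · intro h
      refine (mem_adjointRangeSum_iff hLdense).2
        (exists_inner_eq_add_of_ker hLclosed hA₂ fun x hL0 hH0 => ?_)
      refine inner_eq_zero_of_aPosterioriError_lt_top hb h ?_
      rw [energyForm_apply, hL0, hH0, inner_zero_right, inner_zero_right, add_zero]
    · intro h
      obtain ⟨p, hp⟩ := hsolve ℓ h
      rw [aPosterioriError_ellipsoid hB hsymm hb hp]
      exact ENNReal.ofReal_lt_top
  refine ⟨hfinite, ⟨φ₀, (exists_aPosterioriEuler_iff hLdense y φ₀).2 hφ₀⟩, fun ℓ hℓ => ⟨?_, ?_⟩,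
    fun φ q hφq => ?_⟩
  · obtain ⟨p, hp⟩ := hsolve ℓ hℓ
    exact ⟨p, (exists_aPrioriEuler_iff hLdense ℓ p).2 hp⟩
  · intro p z hpz u c
    have hp := (exists_aPrioriEuler_iff hLdense ℓ p).1 ⟨z, hpz⟩
    exact (aPrioriRisk_le_ofReal_energyForm hQ₁ hQ₂ hp).trans
      (ofReal_energyForm_le_aPrioriRisk hQ₁ hQ₂ hp u c)
  have hφ := (exists_aPosterioriEuler_iff hLdense y φ).1 ⟨q, hφq⟩
  obtain ⟨hGE, hb⟩ := hE φ hφ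
  have hφG : (φ : X) ∈ G := hGE ▸ center_mem_ellipsoid hb
  have hdir (ℓ : X) (hℓ : ℓ ∈ adjointRangeSum L H) :
      aPosterioriError G ℓ =
          ENNReal.ofReal (√(1 - inner ℝ (Q₂ y) (y - H (φ : X)))) * aPrioriError L H Q₁ Q₂ ℓ ∧
        directionalRadiusAt G ℓ (φ : X) = aPosterioriError G ℓ := by
    obtain ⟨p, hp⟩ := hsolve ℓ hℓ
    rw [hGE, directionalRadiusAt_ellipsoid_center hB hsymm hb hp,
      aPosterioriError_ellipsoid hB hsymm hb hp,
      aPrioriError_eq_ofReal_sqrt_energyForm hQ₁ hQ₂ hp, ENNReal.ofReal_mul (Real.sqrt_nonneg _)]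
    exact ⟨rfl, rfl⟩
  refine ⟨hφG, hb, fun ℓ hℓ => ⟨(hdir ℓ hℓ).1, (hdir ℓ hℓ).2, ?_, ?_⟩, fun hfin => ?_⟩
  · obtain ⟨p, hp⟩ := hsolve ℓ hℓ
    rw [hGE]
    exact isAPosterioriEstimation_ellipsoid hB hsymm hb hp
  · intro p z hpz
    have hp := (exists_aPrioriEuler_iff hLdense ℓ p).1 ⟨z, hpz⟩
    rw [← hp, ← inner_apply_comm_of_isPositive hQ₂, ← hφ]
    exact hsymm.eq p φ
  · have hrefl : ∀ x ∈ G, (φ : X) + φ - x ∈ G := by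
      rw [hGE]
      exact fun x => mem_ellipsoid_reflection
    have hbdd : radiusAt G (φ : X) < ⊤ := by
      rw [hGE] at hfin ⊢
      exact radiusAt_ellipsoid_energyForm_lt_top hLclosed hA₂ hQ₁ hQ₂ hb hfin
    refine ⟨le_antisymm (iInf₂_le _ hφG) (le_iInf₂ fun ψ _ => radiusAt_le_of_symmetric hrefl ψ),
      ?_, hbdd, fun ψ _ => eq_of_radiusAt_eq_of_symmetric hrefl hφG hbdd⟩
    rw [← iSup_directionalRadiusAt_eq_radiusAt]
    simp only [ENNReal.mul_iSup]
    refine iSup_congr fun ℓ => iSup_congr fun _ => ?_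
    have h := hdir ℓ ((hfinite ℓ).1 (hfin ℓ))
    exact h.2.trans h.1
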